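/- Let $L$ be an oriented link in three-space (a smooth embedding of $k\ge 0$ oriented circles in $\mathbb R^3$), let $L^!$ be its mirror image, that is, the image of $L$ under a reflection of $\mathbb R^3$ with the orientation carried along, and let $D$ be any diagram of $L$, that is, a regular projection of a link isotopic to $L$. Let $D^!$ be the diagram obtained from $D$ by exchanging the over-strand and the under-strand at every crossing. Then $D^!$ is a diagram of $L^!$, and for all $i,j\in\mathbb Z$ there is an isomorphism of $\mathbb F_2$-vector spaces $$Kh^{i,j}(L^!)\;\cong\;Kh^{-i,-j}(L),$$ where the Khovanov homology groups over $\mathbb F_2$ are computed from the diagrams $D^!$ and $D$ respectively. Here the Khovanov homology of a link presented by a diagram $D$ with $n_+$ positive and $n_-$ negative crossings is defined as follows. For a set $A$ of crossings, the resolution associated to $A$ is the collection of circles obtained from $D$ by giving each crossing in $A$ the 1-smoothing and every other crossing the 0-smoothing; the 0-smoothing of a positive crossing and the 1-smoothing of a negative crossing are the smoothings compatible with the orientation. Write $\|A\|$ for the number of these circles and let $F(A)=\mathbb F_2[x_\gamma\mid\gamma\text{ a circle of the resolution}]/(x_\gamma^2)$, where a square-free monomial in $m$ variables has degree $|A|+\|A\|-2m$.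 If $B=A\cup\{c\}$ with $c\notin A$, the map $d_{A,B}\colon F(A)\to F(B)$ is, when two circles $\alpha,\alpha'$ merge into $\beta$, the algebra map sending $x_\alpha,x_{\alpha'}$ to $x_\beta$ and fixing the other variables, and, when a circle $\alpha$ splits into $\beta,\beta'$, the linear map sending $x\mapsto(x_\beta+x_{\beta'})x$ and $x\,x_\alpha\mapsto x\,x_\beta x_{\beta'}$ for monomials $x$ not containing $x_\alpha$. With $C^{i,j}=\bigoplus_{|A|=i}F(A)_j$ and $d=\sum d_{A,B}\colon C^{i,j}\to C^{i+1,j}$, one sets $Kh^{i,j}(D)=H^{i+n_-,\,j+2n_--n_+}(C,d)$. -/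

import Mathlib

open scoped ContDiff

/-! ## Oriented links in three-space -/

/-- A smooth oriented link with `k` components in `ℝ³`, given by parametrisations of its
components: smooth `1`-periodic immersions `ℝ → ℝ³` which together embed a disjoint union of
`k` circles. `k = 0` is the empty link. -/
structure OrientedLink (k : ℕ) where
  curve : Fin k → ℝ → (Fin 3 → ℝ)
  smooth : ∀ a, ContDiff ℝ ∞ (curve a)
  periodic : ∀ a t, curve a (t + 1) = curve a t
  immersed : ∀ a t, deriv (curve a) t ≠ 0
  embedded : ∀ a b s t, curve a s = curve b t → a = b ∧ ∃ m : ℤ, s = t + m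

/-- The reflection of `ℝ³` in the plane of the first two coordinates. -/
def reflect (p : Fin 3 → ℝ) : Fin 3 → ℝ := ![p 0, p 1, -p 2]

theorem reflect_reflect (p : Fin 3 → ℝ) : reflect (reflect p) = p := by
  ext i; fin_cases i <;> simp [reflect]

theorem hasDerivAt_reflect {f : ℝ → Fin 3 → ℝ} {f' : Fin 3 → ℝ} {t : ℝ}
    (h : HasDerivAt f f' t) : HasDerivAt (fun s => reflect (f s)) (reflect f') t := by
  rw [hasDerivAt_pi] at h ⊢
  intro i
  fin_cases i
  · simpa [reflect] using h 0
  · simpa [reflect] using h 1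
  · simpa [reflect, Pi.neg_def] using (h 2).neg

namespace OrientedLink

variable {k : ℕ}

/-- The mirror image of a link: its image under a reflection of `ℝ³`, with the orientation
carried along by the reflection. -/
def mirror (L : OrientedLink k) : OrientedLink k where
  curve a t := reflect (L.curve a t)
  smooth a := by
    have h := contDiff_pi.1 (L.smooth a)
    rw [contDiff_pi]
    intro i
    fin_cases i
    · simpa [reflect] using h 0
    · simpa [reflect] using h 1
    · simpa [reflect] using (h 2).neg
  periodic a t := by rw [L.periodic]
  immersed a t h0 := by
    have hd : HasDerivAt (L.curve a) (deriv (L.curve a) t) t :=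
      (((L.smooth a).differentiable (by simp)) t).hasDerivAt
    rw [(hasDerivAt_reflect hd).deriv] at h0
    apply L.immersed a t
    rw [← reflect_reflect (deriv (L.curve a) t), h0]
    ext i; fin_cases i <;> simp [reflect]
  embedded a b s t h := L.embedded a b s t (by
    rw [← reflect_reflect (L.curve a s), h, reflect_reflect])

/-- Two links are isotopic if they are joined by a smooth one-parameter family of links. -/
def Isotopic (L L' : OrientedLink k) : Prop :=
  ∃ H : ℝ → OrientedLink k, H 0 = L ∧ H 1 = L' ∧
    ∀ a, ContDiff ℝ ∞ (fun p : ℝ × ℝ => (H p.1).curve a p.2)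

/-- Two parameters `(a, s)` and `(b, t)` name the same point of the disjoint union of circles
`Fin k × ℝ / ℤ`. -/
def SamePoint (p q : Fin k × ℝ) : Prop := p.1 = q.1 ∧ ∃ m : ℤ, p.2 = q.2 + m

/-- The point of the link with parameter `p`. -/
def point (L : OrientedLink k) (p : Fin k × ℝ) : Fin 3 → ℝ := L.curve p.1 p.2

/-- The velocity vector of the link at the parameter `p`. -/
noncomputable def velocity (L : OrientedLink k) (p : Fin k × ℝ) : Fin 3 → ℝ :=
  deriv (L.curve p.1) p.2

end OrientedLink

/-! ## Oriented link diagrams -/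

/-- The combinatorial data of an oriented link diagram with `n` crossings. A pair
`(c, b) : Fin n × Bool` is the passage of the link through the crossing `c` on the over-strand
(`b = true`) or on the under-strand (`b = false`); `next` sends a passage to the following one
along the oriented link; `positive c` tells whether the crossing `c` is positive; and
`freeCircles` is the number of components of the diagram without crossings. -/
structure LinkDiagram where
  n : ℕ
  next : Equiv.Perm (Fin n × Bool)
  positive : Fin n → Bool
  freeCircles : ℕ

namespace LinkDiagram

/-- The mirror diagram: over-strand and under-strand are exchanged at every crossing (which
turns positive crossings into negative ones and conversely). -/
def mirror (D : LinkDiagram) : LinkDiagram where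
  n := D.n
  next := ((Equiv.refl (Fin D.n)).prodCongr Equiv.boolNot).trans
    (D.next.trans ((Equiv.refl (Fin D.n)).prodCongr Equiv.boolNot))
  positive c := !D.positive c
  freeCircles := D.freeCircles

/-- `D` is read off from the projection of the link `L` to the plane of the first two
coordinates, seen from above, and this projection is regular: it is an immersion whose only
multiple points are finitely many transverse double points. The function `pos` gives the
parameter of each passage. -/
def IsProjectionOf (D : LinkDiagram) {k : ℕ} (L : OrientedLink k) : Prop :=
  (∀ p, L.velocity p 0 ≠ 0 ∨ L.velocity p 1 ≠ 0) ∧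
  ∃ pos : Fin D.n × Bool → Fin k × ℝ,
    -- distinct passages have distinct positions
    (∀ x y, OrientedLink.SamePoint (pos x) (pos y) → x = y) ∧
    -- the two passages at a crossing lie above each other
    (∀ c, L.point (pos (c, true)) 0 = L.point (pos (c, false)) 0 ∧
      L.point (pos (c, true)) 1 = L.point (pos (c, false)) 1 ∧
      L.point (pos (c, false)) 2 < L.point (pos (c, true)) 2) ∧
    -- every double point of the projection is a crossing
    (∀ p q, ¬ OrientedLink.SamePoint p q →
      L.point p 0 = L.point q 0 → L.point p 1 = L.point q 1 →
      ∃ c b, OrientedLink.SamePoint p (pos (c, b)) ∧ OrientedLink.SamePoint q (pos (c, !b))) ∧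
    -- crossings are transverse; a crossing is positive if the over-direction followed by
    -- the under-direction is a positively oriented basis of the plane, otherwise negative
    (∀ c,
      let u := L.velocity (pos (c, true))
      let v := L.velocity (pos (c, false))
      if D.positive c then 0 < u 0 * v 1 - u 1 * v 0 else u 0 * v 1 - u 1 * v 0 < 0) ∧
    -- `next x` is the first passage met when travelling along the link from `x`
    (∀ x, ∃ l : ℝ, 0 < l ∧ l ≤ 1 ∧
      OrientedLink.SamePoint (pos (D.next x)) ((pos x).1, (pos x).2 + l) ∧
      ∀ s, 0 < s → s < l → ∀ y, ¬ OrientedLink.SamePoint (pos y) ((pos x).1, (pos x).2 + s)) ∧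
    -- the components without crossings
    Nat.card {a : Fin k // ∀ x, (pos x).1 ≠ a} = D.freeCircles

/-- `D` is a diagram of the oriented link `L`: it is the projection of a link isotopic
to `L`. -/
def Represents (D : LinkDiagram) {k : ℕ} (L : OrientedLink k) : Prop :=
  ∃ L' : OrientedLink k, L.Isotopic L' ∧ D.IsProjectionOf L'

/-- The number of positive crossings. -/
def nPlus (D : LinkDiagram) : ℕ := (Finset.univ.filter fun c => D.positive c = true).card

/-- The number of negative crossings. -/
def nMinus (D : LinkDiagram) : ℕ := (Finset.univ.filter fun c => D.positive c = false).card

/-! ## Resolutions -/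

/-- The arcs of the diagram: those running from a passage `x` to the passage `next x`, labelled
by `x`, and the components without crossings. -/
abbrev Arc (D : LinkDiagram) : Type := (Fin D.n × Bool) ⊕ Fin D.freeCircles

/-- The arc that starts at the passage `x`. -/
def outArc (D : LinkDiagram) (x : Fin D.n × Bool) : D.Arc := Sum.inl x

/-- The arc that ends at the passage `x`. -/
def inArc (D : LinkDiagram) (x : Fin D.n × Bool) : D.Arc := Sum.inl (D.next.symm x)

/-- In the resolution associated to `A` the crossings in `A` receive the 1-smoothing and the
others the 0-smoothing. The 0-smoothing of a positive crossing and the 1-smoothing of a negative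
crossing are the smoothings that respect the orientation; the other two do not. -/
def SmoothedOriented (D : LinkDiagram) (A : Finset (Fin D.n)) (c : Fin D.n) : Prop :=
  c ∉ A ↔ D.positive c = true

/-- Two ends of arcs are joined at a crossing in the resolution associated to `A`. The oriented
smoothing joins the incoming over-strand to the outgoing under-strand and the incoming
under-strand to the outgoing over-strand; the other smoothing joins the two incoming strands
and the two outgoing strands. -/
inductive Glued (D : LinkDiagram) (A : Finset (Fin D.n)) : D.Arc → D.Arc → Prop
  | oriented (c : Fin D.n) (b : Bool) : D.SmoothedOriented A c →
      Glued D A (D.inArc (c, b)) (D.outArc (c, !b))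
  | incoming (c : Fin D.n) : ¬ D.SmoothedOriented A c →
      Glued D A (D.inArc (c, true)) (D.inArc (c, false))
  | outgoing (c : Fin D.n) : ¬ D.SmoothedOriented A c →
      Glued D A (D.outArc (c, true)) (D.outArc (c, false))

/-- The circles of the resolution associated to `A`: the classes of arcs under the equivalence
relation generated by gluing. -/
abbrev Circle (D : LinkDiagram) (A : Finset (Fin D.n)) : Type := Quot (D.Glued A)

/-- The circle of the resolution associated to `A` that contains the arc `e`. -/
def circle (D : LinkDiagram) (A : Finset (Fin D.n)) (e : D.Arc) : D.Circle A := Quot.mk _ e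

/-! ## The Khovanov complex over the field with two elements -/

/-- A monomial of the cube of resolutions: a set `A` of crossings and a square-free monomial
`∏ x_γ`, `γ ∈ S`, recorded as the set `S` of circles of the resolution associated to `A`. For
fixed `A` these monomials are the standard basis of the truncated polynomial algebra
`𝔽₂[x_γ | γ a circle of the resolution] / (x_γ² = 0)`. -/
structure State (D : LinkDiagram) where
  A : Finset (Fin D.n)
  S : Set (D.Circle A)

instance (D : LinkDiagram) : Finite D.State :=
  Finite.of_injective
    (fun s : D.State => (⟨s.A, s.S⟩ : Σ A : Finset (Fin D.n), Set (D.Circle A)))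
    (by rintro ⟨A, S⟩ ⟨B, T⟩ h; cases h; rfl)

/-- The internal grading `|A| + ‖A‖ - 2m` of a monomial with `m` variables, where `‖A‖` is the
number of circles of the resolution. -/
noncomputable def State.degree {D : LinkDiagram} (s : D.State) : ℤ :=
  (s.A.card : ℤ) + (Nat.card (D.Circle s.A) : ℤ) - 2 * (s.S.ncard : ℤ)

/-- The monomial `t` occurs (with coefficient `1`) in the image of the monomial `s` under the
matrix element of the edge of the cube that adds the crossing `c`. Here `α, α'` are the circles
through the two strands at `c` before the change of smoothing and `β, β'` those after it (in
either smoothing the incoming and the outgoing over-arc lie on different strands at `c`). Circles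
that do not meet `c` are the same before and after.
If `α, α'` merge into `β`, the map is the algebra map `x_α, x_α' ↦ x_β`;
if `α` splits into `β, β'`, the map is `x ↦ (x_β + x_β') x`, `x x_α ↦ x x_β x_β'` on monomials
`x` not involving `x_α`. -/
def OccursAlong (D : LinkDiagram) (c : Fin D.n) (s t : D.State) : Prop :=
  let α := D.circle s.A (D.inArc (c, true))
  let α' := D.circle s.A (D.outArc (c, true))
  let β := D.circle t.A (D.inArc (c, true))
  let β' := D.circle t.A (D.outArc (c, true))
  (∀ e : D.Arc, D.circle s.A e ≠ α → D.circle s.A e ≠ α' →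
    (D.circle s.A e ∈ s.S ↔ D.circle t.A e ∈ t.S)) ∧
  ((α ≠ α' ∧ β = β' ∧
      ((α ∉ s.S ∧ α' ∉ s.S ∧ β ∉ t.S) ∨
       (α ∈ s.S ∧ α' ∉ s.S ∧ β ∈ t.S) ∨
       (α ∉ s.S ∧ α' ∈ s.S ∧ β ∈ t.S))) ∨
   (α = α' ∧ β ≠ β' ∧
      ((α ∉ s.S ∧ β ∈ t.S ∧ β' ∉ t.S) ∨
       (α ∉ s.S ∧ β ∉ t.S ∧ β' ∈ t.S) ∨
       (α ∈ s.S ∧ β ∈ t.S ∧ β' ∈ t.S))))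

/-- The monomial `t` occurs in the differential of the monomial `s`. -/
def Occurs (D : LinkDiagram) (s t : D.State) : Prop :=
  ∃ c, c ∉ s.A ∧ t.A = insert c s.A ∧ D.OccursAlong c s t

/-- The monomials of cohomological degree `i` and internal degree `j`. -/
abbrev Generator (D : LinkDiagram) (i j : ℤ) : Type :=
  {s : D.State // (s.A.card : ℤ) = i ∧ s.degree = j}

noncomputable instance (D : LinkDiagram) (i j : ℤ) : Fintype (D.Generator i j) :=
  Fintype.ofFinite _

/-- The cochain group `C^{i,j}`: the vector space over the field with two elements with basis the
monomials of bidegree `(i, j)`. -/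
abbrev Cochain (D : LinkDiagram) (i j : ℤ) : Type := D.Generator i j → ZMod 2

open scoped Classical in
/-- The differential, from `C^{i,j}` to `C^{i',j}` where `i' = i + 1`: a basis monomial `s` goes
to the sum of the monomials `t` that occur in its differential. -/
noncomputable def differential (D : LinkDiagram) (i i' j : ℤ) :
    D.Cochain i j →ₗ[ZMod 2] D.Cochain i' j :=
  Matrix.mulVecLin (Matrix.of fun t s => if D.Occurs s.1 t.1 then 1 else 0)

/-- The cohomology `H^{i,j}` of the complex: cocycles in `C^{i,j}` modulo coboundaries. -/
abbrev Homology (D : LinkDiagram) (i j : ℤ) : Type :=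
  LinearMap.ker (D.differential i (i + 1) j) ⧸
    (LinearMap.range (D.differential (i - 1) i j)).comap
      (LinearMap.ker (D.differential i (i + 1) j)).subtype

/-- The Khovanov homology `Kh^{i,j}` with coefficients in the field with two elements of the link
presented by the diagram `D`. -/
abbrev Kh (D : LinkDiagram) (i j : ℤ) : Type :=
  D.Homology (i + D.nMinus) (j + 2 * D.nMinus - D.nPlus)

end LinkDiagram

/-! Reflection in the projection plane keeps the planar picture and reverses heights, so every
crossing is exchanged and changes sign (`IsProjectionOf.mirror`).

For homology, the resolution of the mirror at `A` has the circles of the original resolution at `Aᶜ`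
(`mirrorCircle`). Complementing both the crossings and the variables of a monomial matches bases in
bidegrees adding up to `(n, n)`. It turns the merge table into the transposed split table and
conversely (`surgery_transpose`), so the mirror complex is the dual complex in the monomial bases
(`differentialMatrix_mirror`).

Over a field it remains to compare dimensions. These depend only on matrix ranks
(`finrank_homology`), which transposition preserves; the formula does not need `d² = 0`. The shifts
by `n₊` and `n₋` turn `(n, n)`-complementary bidegrees into opposite ones. -/

namespace OrientedLink

variable {k : ℕ}

/-! ### Mirror images of isotopies and projections -/

theorem contDiff_reflect : ContDiff ℝ ∞ reflect := by
  rw [contDiff_pi]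
  intro i
  fin_cases i
  · simpa [reflect] using contDiff_apply ℝ ℝ (0 : Fin 3)
  · simpa [reflect] using contDiff_apply ℝ ℝ (1 : Fin 3)
  · simpa [reflect] using (contDiff_apply ℝ ℝ (2 : Fin 3)).neg

theorem Isotopic.mirror {L L' : OrientedLink k} (h : L.Isotopic L') :
    L.mirror.Isotopic L'.mirror := by
  obtain ⟨H, rfl, rfl, hH⟩ := h
  exact ⟨fun s => (H s).mirror, rfl, rfl, fun a => contDiff_reflect.comp (hH a)⟩

theorem mirror_velocity (L : OrientedLink k) (p : Fin k × ℝ) :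
    L.mirror.velocity p = reflect (L.velocity p) :=
  (hasDerivAt_reflect
    (((L.smooth p.1).differentiable (by simp)) p.2).hasDerivAt).deriv

end OrientedLink

@[simp] theorem reflect_zero_apply (p : Fin 3 → ℝ) : reflect p 0 = p 0 := rfl

@[simp] theorem reflect_one_apply (p : Fin 3 → ℝ) : reflect p 1 = p 1 := rfl

namespace LinkDiagram

/-- Exchange of the two passages at every crossing. -/
def flip (n : ℕ) : Equiv.Perm (Fin n × Bool) := (Equiv.refl (Fin n)).prodCongr Equiv.boolNot

@[simp] theorem flip_mk {n : ℕ} (c : Fin n) (b : Bool) : flip n (c, b) = (c, !b) := rfl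

@[simp] theorem flip_flip {n : ℕ} (x : Fin n × Bool) : flip n (flip n x) = x := by
  obtain ⟨c, b⟩ := x
  rw [flip_mk, flip_mk, Bool.not_not]

theorem IsProjectionOf.mirror {D : LinkDiagram} {k : ℕ} {L : OrientedLink k}
    (h : D.IsProjectionOf L) : D.mirror.IsProjectionOf L.mirror := by
  obtain ⟨himm, pos, hinj, hover, hdouble, hsign, hnext, hfree⟩ := h
  refine ⟨fun p => by simpa [L.mirror_velocity] using himm p,
    fun x => pos (flip D.n x), fun x y hxy => (flip D.n).injective (hinj _ _ hxy),
    fun c => ?_, fun p q hpq h0 h1 => ?_, fun c => ?_, fun x => ?_, ?_⟩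
  · obtain ⟨h0, h1, h2⟩ := hover c
    exact ⟨h0.symm, h1.symm, neg_lt_neg h2⟩
  · obtain ⟨c, b, hp, hq⟩ := hdouble p q hpq h0 h1
    refine ⟨c, !b, ?_, ?_⟩
    · rwa [← Bool.not_not b] at hp
    · rwa [← Bool.not_not (!b)] at hq
  -- The planar velocities trade places, which negates their determinant.
  · have hc := hsign c
    have hT : pos (flip D.n (c, true)) = pos (c, false) := rfl
    have hF : pos (flip D.n (c, false)) = pos (c, true) := rfl
    have hp : D.mirror.positive c = !D.positive c := rfl
    simp only [hp, L.mirror_velocity, reflect_zero_apply, reflect_one_apply] at hc ⊢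
    erw [hT, hF]
    cases hpos : D.positive c <;> simp [hpos] at hc ⊢ <;> linarith
  · obtain ⟨l, hl, hl', hlnext, hfirst⟩ := hnext (flip D.n x)
    -- The mirror's `next` is `D.next` conjugated by `flip`; its outer `flip` cancels the one in the
    -- new position map.
    exact ⟨l, hl, hl', by rwa [← flip_flip (D.next (flip D.n x))] at hlnext,
      fun s hs hsl y => hfirst s hs hsl (flip D.n y)⟩
  · rw [show D.mirror.freeCircles = D.freeCircles from rfl, ← hfree]
    refine Nat.card_congr (Equiv.subtypeEquivRight fun a => ?_)
    exact (flip D.n).forall_congr_left.trans (by simp)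

theorem Represents.mirror {D : LinkDiagram} {k : ℕ} {L : OrientedLink k}
    (h : D.Represents L) : D.mirror.Represents L.mirror := by
  obtain ⟨L', hL, hD⟩ := h
  exact ⟨L'.mirror, hL.mirror, hD.mirror⟩

/-! ### Resolutions of the mirror diagram -/

/-- The arcs of the mirror diagram are those of the diagram. -/
def mirrorArc (D : LinkDiagram) : D.mirror.Arc ≃ D.Arc :=
  (flip D.n).sumCongr (Equiv.refl (Fin D.freeCircles))

theorem mirrorArc_inArc (D : LinkDiagram) (c : Fin D.n) (b : Bool) :
    D.mirrorArc (D.mirror.inArc (c, b)) = D.inArc (c, !b) := by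
  change Sum.inl (flip D.n (D.mirror.next.symm (c, b))) = Sum.inl (D.next.symm (c, !b))
  exact congrArg Sum.inl (flip_flip _)

theorem mirrorArc_outArc (D : LinkDiagram) (c : Fin D.n) (b : Bool) :
    D.mirrorArc (D.mirror.outArc (c, b)) = D.outArc (c, !b) := rfl

/-- Sign and membership in the set are both negated, so their agreement is unaffected. -/
theorem smoothedOriented_mirror (D : LinkDiagram) (A : Finset (Fin D.n)) (c : Fin D.n) :
    D.mirror.SmoothedOriented A c ↔ D.SmoothedOriented Aᶜ c := by
  change (c ∉ A ↔ (!D.positive c) = true) ↔ (c ∉ Aᶜ ↔ D.positive c = true)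
  rw [Finset.mem_compl]
  cases D.positive c <;> simp

theorem circle_mirrorArc_of_glued (D : LinkDiagram) {A : Finset (Fin D.n)}
    {e f : D.mirror.Arc} (h : D.mirror.Glued A e f) :
    D.circle Aᶜ (D.mirrorArc e) = D.circle Aᶜ (D.mirrorArc f) := by
  have hin (c : Fin D.mirror.n) (b : Bool) :
      D.mirrorArc (D.mirror.inArc (c, b)) = D.inArc (c, !b) := D.mirrorArc_inArc c b
  have hout (c : Fin D.mirror.n) (b : Bool) :
      D.mirrorArc (D.mirror.outArc (c, b)) = D.outArc (c, !b) := rfl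
  cases h with
  | oriented c b h =>
    rw [hin, hout]
    exact Quot.sound (.oriented (D := D) c (!b) ((D.smoothedOriented_mirror A c).1 h))
  | incoming c h =>
    rw [hin, hin]
    exact (Quot.sound (.incoming (D := D) c (mt (D.smoothedOriented_mirror A c).2 h))).symm
  | outgoing c h =>
    rw [hout, hout]
    exact (Quot.sound (.outgoing (D := D) c (mt (D.smoothedOriented_mirror A c).2 h))).symm

theorem circle_mirrorArc_symm_of_glued (D : LinkDiagram) {A : Finset (Fin D.n)}
    {e f : D.Arc} (h : D.Glued Aᶜ e f) :
    D.mirror.circle A (D.mirrorArc.symm e) = D.mirror.circle A (D.mirrorArc.symm f) := by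
  have hin (c : Fin D.n) (b : Bool) :
      D.mirrorArc.symm (D.inArc (c, b)) = D.mirror.inArc (c, !b) := by
    rw [Equiv.symm_apply_eq, mirrorArc_inArc, Bool.not_not]
  have hout (c : Fin D.n) (b : Bool) :
      D.mirrorArc.symm (D.outArc (c, b)) = D.mirror.outArc (c, !b) := by
    rw [Equiv.symm_apply_eq, mirrorArc_outArc, Bool.not_not]
  cases h with
  | oriented c b h =>
    rw [hin, hout]
    exact Quot.sound (.oriented (D := D.mirror) c (!b) ((D.smoothedOriented_mirror A c).2 h))
  | incoming c h =>
    rw [hin, hin]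
    exact (Quot.sound
      (.incoming (D := D.mirror) c (mt (D.smoothedOriented_mirror A c).1 h))).symm
  | outgoing c h =>
    rw [hout, hout]
    exact (Quot.sound
      (.outgoing (D := D.mirror) c (mt (D.smoothedOriented_mirror A c).1 h))).symm

/-- The resolution of the mirror diagram associated to `A` has the same circles as the
resolution of the diagram associated to the complement of `A`. -/
def mirrorCircle (D : LinkDiagram) (A : Finset (Fin D.n)) :
    D.mirror.Circle A ≃ D.Circle Aᶜ where
  toFun := Quot.lift (fun e => D.circle Aᶜ (D.mirrorArc e))
    fun _ _ h => D.circle_mirrorArc_of_glued h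
  invFun := Quot.lift (fun e => D.mirror.circle A (D.mirrorArc.symm e))
    fun _ _ h => D.circle_mirrorArc_symm_of_glued h
  left_inv := by
    rintro ⟨e⟩
    exact congrArg (D.mirror.circle A) (D.mirrorArc.symm_apply_apply e)
  right_inv := by
    rintro ⟨e⟩
    exact congrArg (D.circle Aᶜ) (D.mirrorArc.apply_symm_apply e)

/-! ### The circles through a crossing -/

section Crossing

variable (D : LinkDiagram) (A : Finset (Fin D.n)) (c : Fin D.n)

/-- The arc `e` lies on one of the circles that pass through the crossing `c`. -/
def Meets (e : D.Arc) : Prop :=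
  D.circle A e = D.circle A (D.inArc (c, true)) ∨ D.circle A e = D.circle A (D.outArc (c, true))

/-- The under-strands at a crossing lie on the circles through the over-strands, either
respectively or exchanged. -/
theorem circle_false :
    (D.circle A (D.inArc (c, false)) = D.circle A (D.inArc (c, true)) ∧
      D.circle A (D.outArc (c, false)) = D.circle A (D.outArc (c, true))) ∨
    (D.circle A (D.inArc (c, false)) = D.circle A (D.outArc (c, true)) ∧
      D.circle A (D.outArc (c, false)) = D.circle A (D.inArc (c, true))) := by
  by_cases h : D.SmoothedOriented A c
  · exact .inr ⟨Quot.sound (.oriented c false h), (Quot.sound (.oriented c true h)).symm⟩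
  · exact .inl ⟨(Quot.sound (.incoming c h)).symm, (Quot.sound (.outgoing c h)).symm⟩

theorem meets_inArc (b : Bool) : D.Meets A c (D.inArc (c, b)) := by
  cases b
  · rcases D.circle_false A c with h | h
    exacts [.inl h.1, .inr h.1]
  · exact .inl rfl

theorem meets_outArc (b : Bool) : D.Meets A c (D.outArc (c, b)) := by
  cases b
  · rcases D.circle_false A c with h | h
    exacts [.inr h.2, .inl h.2]
  · exact .inr rfl

variable {D A c}

theorem meets_congr {e f : D.Arc} (h : D.circle A e = D.circle A f) :
    D.Meets A c e ↔ D.Meets A c f := by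
  unfold Meets
  rw [h]

/-- Away from `c` the two resolutions glue alike; at `c` every arc end involved meets `c`, whatever
the smoothing. -/
theorem meets_iff_of_glued {B : Finset (Fin D.n)} (hAB : ∀ c', c' ≠ c → (c' ∈ A ↔ c' ∈ B))
    {e f : D.Arc} (h : D.Glued B e f) : D.Meets A c e ↔ D.Meets A c f := by
  have hs (c' : Fin D.n) (hc : c' ≠ c) : D.SmoothedOriented A c' ↔ D.SmoothedOriented B c' := by
    unfold SmoothedOriented
    rw [hAB c' hc]
  cases h with
  | oriented c' b h =>
    by_cases hc : c' = c
    · subst hc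
      exact iff_of_true (D.meets_inArc A _ _) (D.meets_outArc A _ _)
    · exact meets_congr (Quot.sound (.oriented c' b ((hs c' hc).2 h)))
  | incoming c' h =>
    by_cases hc : c' = c
    · subst hc
      exact iff_of_true (D.meets_inArc A _ _) (D.meets_inArc A _ _)
    · exact meets_congr (Quot.sound (.incoming c' (mt (hs c' hc).1 h)))
  | outgoing c' h =>
    by_cases hc : c' = c
    · subst hc
      exact iff_of_true (D.meets_outArc A _ _) (D.meets_outArc A _ _)
    · exact meets_congr (Quot.sound (.outgoing c' (mt (hs c' hc).1 h)))

theorem Meets.of_eq_off {B : Finset (Fin D.n)} (hAB : ∀ c', c' ≠ c → (c' ∈ A ↔ c' ∈ B))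
    {e : D.Arc} (h : D.Meets B c e) : D.Meets A c e := by
  have key {e f : D.Arc} (h : D.circle B e = D.circle B f) :
      D.Meets A c e ↔ D.Meets A c f :=
    -- Being invariant under the gluings of `B`, the predicate descends to circles of `B`.
    iff_of_eq (congrArg (Quot.lift (D.Meets A c)
      fun _ _ h => propext (meets_iff_of_glued hAB h)) h)
  rcases h with h | h
  · exact (key h).2 (D.meets_inArc A c true)
  · exact (key h).2 (D.meets_outArc A c true)

/-- Changing the smoothing of a crossing does not affect which arcs lie on the circles
through it. -/
theorem meets_iff_of_eq_off {B : Finset (Fin D.n)} (hAB : ∀ c', c' ≠ c → (c' ∈ A ↔ c' ∈ B))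
    (e : D.Arc) : D.Meets A c e ↔ D.Meets B c e :=
  ⟨Meets.of_eq_off fun c' hc => (hAB c' hc).symm, Meets.of_eq_off hAB⟩

end Crossing

/-! ### Duality of states -/

/-- The monomial of the diagram dual to a monomial of the mirror diagram: the set of crossings
and the set of variables are replaced by their complements. -/
def dual (D : LinkDiagram) (s : D.mirror.State) : D.State where
  A := (show Finset (Fin D.n) from s.A)ᶜ
  S := (D.mirrorCircle s.A).symm ⁻¹' s.Sᶜ

theorem dual_bijective (D : LinkDiagram) : Function.Bijective D.dual := by
  constructor
  · rintro ⟨A, S⟩ ⟨B, T⟩ h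
    obtain rfl : A = B := compl_injective (congrArg State.A h)
    have hS : (D.mirrorCircle A).symm ⁻¹' Sᶜ = (D.mirrorCircle A).symm ⁻¹' Tᶜ := by
      simpa [dual] using h
    rw [compl_injective ((D.mirrorCircle A).symm.surjective.preimage_injective hS)]
  · rintro ⟨A, S⟩
    -- Presenting `A` as a complement puts `S` in the codomain of `mirrorCircle B`, with no
    -- transport between circle types.
    obtain ⟨B, rfl⟩ : ∃ B, A = Bᶜ := ⟨Aᶜ, (compl_compl A).symm⟩
    refine ⟨⟨B, (D.mirrorCircle B ⁻¹' S)ᶜ⟩, ?_⟩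
    simp only [dual, compl_compl, ← Set.preimage_comp, Equiv.self_comp_symm, Set.preimage_id]

theorem circle_mem_dual (D : LinkDiagram) (s : D.mirror.State) (e : D.mirror.Arc) :
    D.circle (D.dual s).A (D.mirrorArc e) ∈ (D.dual s).S ↔ D.mirror.circle s.A e ∉ s.S := by
  change (D.mirrorCircle s.A).symm (D.mirrorCircle s.A (D.mirror.circle s.A e)) ∉ s.S ↔ _
  rw [Equiv.symm_apply_apply]

theorem circle_dual_eq_iff (D : LinkDiagram) (s : D.mirror.State) (e f : D.mirror.Arc) :
    D.circle (D.dual s).A (D.mirrorArc e) = D.circle (D.dual s).A (D.mirrorArc f) ↔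
      D.mirror.circle s.A e = D.mirror.circle s.A f :=
  (D.mirrorCircle s.A).apply_eq_iff_eq (x := D.mirror.circle s.A e)
    (y := D.mirror.circle s.A f)

theorem card_A_dual (D : LinkDiagram) (s : D.mirror.State) :
    ((D.dual s).A.card : ℤ) = D.n - s.A.card := by
  have h : s.A.card + (D.dual s).A.card = D.n :=
    (Finset.card_add_card_compl s.A).trans (Fintype.card_fin D.n)
  omega

/-- With `r` circles, `(n - |A|) + r - 2(r - m) = n - (|A| + r - 2m)`. -/
theorem degree_dual (D : LinkDiagram) (s : D.mirror.State) :
    (D.dual s).degree = D.n - s.degree := by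
  have hcard : Nat.card (D.Circle (D.dual s).A) = Nat.card (D.mirror.Circle s.A) :=
    (Nat.card_congr (D.mirrorCircle s.A)).symm
  have hS : (D.dual s).S.ncard = s.Sᶜ.ncard :=
    Set.ncard_preimage_of_injective_subset_range (D.mirrorCircle s.A).symm.injective
      fun _ _ => (D.mirrorCircle s.A).symm.surjective _
  have hadd := Set.ncard_add_ncard_compl s.S
  have hA := D.card_A_dual s
  simp only [State.degree]
  omega

/-- The condition of `OccursAlong` for maps `q` and `r` that send arcs to circles before and
after the change of smoothing, monomials `S` and `T`, and the circles `α`, `α'` and `β`, `β'`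
through the two strands before and after the change. -/
def Surgery {E X Y : Type*} (q : E → X) (S : Set X) (r : E → Y) (T : Set Y) (α α' : X)
    (β β' : Y) : Prop :=
  (∀ e, q e ≠ α → q e ≠ α' → (q e ∈ S ↔ r e ∈ T)) ∧
  ((α ≠ α' ∧ β = β' ∧
      ((α ∉ S ∧ α' ∉ S ∧ β ∉ T) ∨ (α ∈ S ∧ α' ∉ S ∧ β ∈ T) ∨ (α ∉ S ∧ α' ∈ S ∧ β ∈ T))) ∨
   (α = α' ∧ β ≠ β' ∧
      ((α ∉ S ∧ β ∈ T ∧ β' ∉ T) ∨ (α ∉ S ∧ β ∉ T ∧ β' ∈ T) ∨ (α ∈ S ∧ β ∈ T ∧ β' ∈ T))))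

/-! ### Symmetry and transposition of merges and splits -/

section Surgery

variable {E F X Y X' Y' : Type*} {q : E → X} {S : Set X} {r : E → Y} {T : Set Y}

/-- Needed because `OccursAlong` names circles by over-arcs, which mirroring turns into under-arcs.
-/
theorem surgery_swap_left {α α' : X} {β β' : Y} :
    Surgery q S r T α α' β β' ↔ Surgery q S r T α' α β β' := by
  by_cases h : α = α'
  · subst h
    rfl
  · refine and_congr (forall_congr' fun e => imp.swap) ?_
    simp only [ne_eq, h, Ne.symm h, not_false_eq_true, true_and, false_and, or_false]
    exact and_congr_right fun _ => by tauto

theorem surgery_swap_right {α α' : X} {β β' : Y} :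
    Surgery q S r T α α' β β' ↔ Surgery q S r T α α' β' β := by
  by_cases h : β = β'
  · subst h
    rfl
  · refine and_congr Iff.rfl ?_
    simp only [ne_eq, h, Ne.symm h, not_false_eq_true, true_and, false_and, and_false, false_or]
    exact and_congr_right fun _ => by tauto

/-- Read backwards with complemented monomials, the merge `1 ↦ 1` becomes the split `x_β ↦ x_α
x_α'`, while `x_α ↦ x_β` and `x_α' ↦ x_β` become the two terms of `1 ↦ x_α + x_α'`. Hypothesis `hqr`
makes the clause on distant circles range over the same arcs on both sides. -/
theorem surgery_transpose {q' : F → X'} {S' : Set X'} {r' : F → Y'} {T' : Set Y'} {φ : E → F}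
    {a a' : E} (hφ : φ.Surjective) (hq : ∀ e f, q' (φ e) = q' (φ f) ↔ q e = q f)
    (hS : ∀ e, q' (φ e) ∈ S' ↔ q e ∉ S) (hr : ∀ e f, r' (φ e) = r' (φ f) ↔ r e = r f)
    (hT : ∀ e, r' (φ e) ∈ T' ↔ r e ∉ T)
    (hqr : ∀ e, (q e = q a ∨ q e = q a') ↔ (r e = r a ∨ r e = r a')) :
    Surgery q S r T (q a) (q a') (r a) (r a') ↔
      Surgery r' T' q' S' (r' (φ a)) (r' (φ a')) (q' (φ a)) (q' (φ a')) := by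
  unfold Surgery
  rw [hφ.forall]
  simp only [hq, hS, hr, hT, ne_eq, not_not]
  refine and_congr (forall_congr' fun e => ?_) ?_
  · rw [← and_imp, ← and_imp, ← not_or, ← not_or, hqr e, not_iff_not, iff_comm]
    exact imp_congr_right fun _ => iff_comm
  · by_cases h : q a = q a' <;> by_cases h' : r a = r a' <;>
      simp only [h, h', not_true_eq_false, not_false_eq_true, true_and, false_and, or_false,
        false_or] <;> tauto

end Surgery

/-- Under duality, a matrix element of the differential of the mirror diagram becomes the
transposed matrix element for the diagram. -/
theorem occursAlong_mirror_iff (D : LinkDiagram) (c : Fin D.n) {s t : D.mirror.State}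
    (hst : t.A = insert (show Fin D.mirror.n from c) s.A) :
    D.mirror.OccursAlong c s t ↔ D.OccursAlong c (D.dual t) (D.dual s) := by
  have hmeets (e : D.mirror.Arc) : D.mirror.Meets s.A c e ↔ D.mirror.Meets t.A c e :=
    meets_iff_of_eq_off (fun c' hc => hst ▸ (Finset.mem_insert.trans (or_iff_right hc)).symm) e
  refine (surgery_transpose D.mirrorArc.surjective (D.circle_dual_eq_iff s)
    (D.circle_mem_dual s) (D.circle_dual_eq_iff t) (D.circle_mem_dual t) hmeets).trans ?_
  have hin : D.mirrorArc (D.mirror.inArc (c, true)) = D.inArc (c, false) :=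
    D.mirrorArc_inArc c true
  have hout : D.mirrorArc (D.mirror.outArc (c, true)) = D.outArc (c, false) := rfl
  rw [hin, hout]
  -- In each resolution the under-arcs name the same two circles as the over-arcs, perhaps
  -- exchanged.
  rcases D.circle_false (D.dual t).A c with ⟨h₁, h₂⟩ | ⟨h₁, h₂⟩ <;>
    rcases D.circle_false (D.dual s).A c with ⟨h₃, h₄⟩ | ⟨h₃, h₄⟩ <;> rw [h₁, h₂, h₃, h₄]
  · rfl
  · exact surgery_swap_right
  · exact surgery_swap_left
  · exact surgery_swap_left.trans surgery_swap_right

theorem _root_.Finset.eq_insert_iff_compl_eq_insert {α : Type*} [Fintype α] [DecidableEq α]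
    {A B : Finset α} {c : α} :
    (c ∉ A ∧ B = insert c A) ↔ (c ∉ Bᶜ ∧ Aᶜ = insert c Bᶜ) := by
  constructor
  · rintro ⟨h, rfl⟩
    exact ⟨by simp, by rw [Finset.compl_insert, Finset.insert_erase (Finset.mem_compl.2 h)]⟩
  · rintro ⟨h, h'⟩
    have hA : A = B.erase c := by rw [← compl_compl A, h', Finset.compl_insert, compl_compl]
    rw [hA, Finset.insert_erase (by simpa using h)]
    exact ⟨Finset.notMem_erase c B, rfl⟩

theorem occurs_mirror_iff (D : LinkDiagram) (s t : D.mirror.State) :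
    D.mirror.Occurs s t ↔ D.Occurs (D.dual t) (D.dual s) :=
  exists_congr fun c => and_assoc.symm.trans <|
    (and_congr_right fun h => D.occursAlong_mirror_iff c h.2).trans <|
      (and_congr_left' Finset.eq_insert_iff_compl_eq_insert).trans and_assoc

/-! ### Homology -/

/-- Duality as a bijection between the monomials of complementary bidegrees. -/
noncomputable def dualGenerator (D : LinkDiagram) {i j i' j' : ℤ} (hi : i + i' = D.n)
    (hj : j + j' = D.n) : D.mirror.Generator i j ≃ D.Generator i' j' :=
  (Equiv.ofBijective D.dual D.dual_bijective).subtypeEquiv fun s => by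
    rw [Equiv.ofBijective_apply, D.card_A_dual, D.degree_dual]
    omega

open scoped Classical in
/-- The matrix of the differential. -/
noncomputable def differentialMatrix (D : LinkDiagram) (i i' j : ℤ) :
    Matrix (D.Generator i' j) (D.Generator i j) (ZMod 2) :=
  Matrix.of fun t s => if D.Occurs s.1 t.1 then 1 else 0

theorem differential_eq (D : LinkDiagram) (i i' j : ℤ) :
    D.differential i i' j = (D.differentialMatrix i i' j).mulVecLin := rfl

/-- The differentials of the mirror diagram are the transposes of those of the diagram. -/
theorem differentialMatrix_mirror (D : LinkDiagram) {i₁ i₂ j k₁ k₂ l : ℤ}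
    (h₁ : i₁ + k₁ = D.n) (h₂ : i₂ + k₂ = D.n) (hj : j + l = D.n) :
    D.mirror.differentialMatrix i₁ i₂ j =
      (D.differentialMatrix k₂ k₁ l).transpose.submatrix (D.dualGenerator h₂ hj)
        (D.dualGenerator h₁ hj) := by
  classical
  ext t s
  exact if_congr (D.occurs_mirror_iff s.1 t.1) rfl rfl

/-- The quotient has dimension `dim ker g - dim (range f ∩ ker g)`; rank-nullity for `g` and for `g`
restricted to `range f` evaluates both terms. The term `g ∘ₗ f` replaces the assumption that it
vanishes. -/
theorem _root_.LinearMap.finrank_ker_quotient_range {K U V W : Type*} [Field K]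
    [AddCommGroup U] [Module K U] [AddCommGroup V] [Module K V] [FiniteDimensional K V]
    [AddCommGroup W] [Module K W] (f : U →ₗ[K] V) (g : V →ₗ[K] W) :
    Module.finrank K
        (LinearMap.ker g ⧸ (LinearMap.range f).comap (LinearMap.ker g).subtype) +
      Module.finrank K (LinearMap.range g) + Module.finrank K (LinearMap.range f) =
        Module.finrank K V + Module.finrank K (LinearMap.range (g ∘ₗ f)) := by
  have h₁ := Submodule.finrank_quotient_add_finrank
    ((LinearMap.range f).comap (LinearMap.ker g).subtype)
  have h₂ := g.finrank_range_add_finrank_ker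
  have h₃ := (g.domRestrict (LinearMap.range f)).finrank_range_add_finrank_ker
  rw [← Submodule.finrank_map_subtype_eq, Submodule.map_comap_subtype] at h₁
  rw [LinearMap.range_domRestrict, LinearMap.ker_domRestrict,
    ← Submodule.finrank_map_subtype_eq (LinearMap.range f), Submodule.map_comap_subtype,
    inf_comm, ← LinearMap.range_comp] at h₃
  omega

theorem finrank_homology (D : LinkDiagram) (i j : ℤ) :
    Module.finrank (ZMod 2) (D.Homology i j) + (D.differentialMatrix i (i + 1) j).rank +
        (D.differentialMatrix (i - 1) i j).rank =
      Fintype.card (D.Generator i j) +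
        (D.differentialMatrix i (i + 1) j * D.differentialMatrix (i - 1) i j).rank := by
  have h := LinearMap.finrank_ker_quotient_range (D.differential (i - 1) i j)
    (D.differential i (i + 1) j)
  rw [Module.finrank_fintype_fun_eq_card] at h
  rwa [differential_eq D (i - 1), differential_eq D i, ← Matrix.mulVecLin_mul] at h

theorem nonempty_homology_mirror (D : LinkDiagram) {i j i' j' : ℤ} (hi : i + i' = D.n)
    (hj : j + j' = D.n) :
    Nonempty (D.mirror.Homology i j ≃ₗ[ZMod 2] D.Homology i' j') := by
  refine FiniteDimensional.nonempty_linearEquiv_of_finrank_eq ?_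
  have h := D.finrank_homology i' j'
  have h' := D.mirror.finrank_homology i j
  have hi₁ : i + 1 + (i' - 1) = D.n := by omega
  have hi₂ : i - 1 + (i' + 1) = D.n := by omega
  -- Transposition exchanges the outgoing and incoming differentials, so the two ranks swap roles
  -- and the product is reversed.
  rw [D.differentialMatrix_mirror hi hi₁ hj, D.differentialMatrix_mirror hi₂ hi hj,
    Matrix.submatrix_mul_equiv, Matrix.rank_submatrix, Matrix.rank_submatrix,
    Matrix.rank_submatrix, ← Matrix.transpose_mul, Matrix.rank_transpose,
    Matrix.rank_transpose, Matrix.rank_transpose,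
    Fintype.card_congr (D.dualGenerator hi hj)] at h'
  omega

/-! ### Crossing counts and the degree shift -/

theorem nPlus_add_nMinus (D : LinkDiagram) : D.nPlus + D.nMinus = D.n := by
  have h := Finset.card_filter_add_card_filter_not (s := (Finset.univ : Finset (Fin D.n)))
    (fun c => D.positive c = true)
  simpa [nPlus, nMinus] using h

theorem nPlus_mirror (D : LinkDiagram) : D.mirror.nPlus = D.nMinus := by
  change (Finset.univ.filter fun c : Fin D.n => (!D.positive c) = true).card = _
  simp [nMinus]

theorem nMinus_mirror (D : LinkDiagram) : D.mirror.nMinus = D.nPlus := by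
  change (Finset.univ.filter fun c : Fin D.n => (!D.positive c) = false).card = _
  simp [nPlus]

theorem nonempty_kh_mirror (D : LinkDiagram) (i j : ℤ) :
    Nonempty (D.mirror.Kh i j ≃ₗ[ZMod 2] D.Kh (-i) (-j)) := by
  have h := D.nPlus_add_nMinus
  refine D.nonempty_homology_mirror ?_ ?_ <;> rw [nMinus_mirror] <;> try rw [nPlus_mirror]
  -- `(i + n₊) + (-i + n₋) = n` and `(j + 2n₊ - n₋) + (-j + 2n₋ - n₊) = n`.
  all_goals omega

end LinkDiagram

theorem mainTheorem3 {k : ℕ} (L : OrientedLink k) (D : LinkDiagram) (hD : D.Represents L) :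
    D.mirror.Represents L.mirror ∧
      ∀ i j : ℤ, Nonempty (D.mirror.Kh i j ≃ₗ[ZMod 2] D.Kh (-i) (-j)) :=
  ⟨hD.mirror, D.nonempty_kh_mirror⟩
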